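/- Let $A$ be an Artin algebra, i.e. an algebra over a commutative Artinian ring $R$ that is finitely generated as an $R$-module. All modules are finitely generated, and modules are left modules unless stated otherwise. For a ring $\Lambda$ and a $\Lambda$-module $M$, let $M^*=\operatorname{Hom}_\Lambda(M,\Lambda)$ be its dual, a right $\Lambda$-module. A (left or right) $\Lambda$-module $M$ is *semi-Gorenstein-projective* if $\operatorname{Ext}^i_\Lambda(M,\Lambda)=0$ for all $i\ge 1$; a left module $M$ is *double semi-Gorenstein-projective* if both $M$ and $M^*$ are semi-Gorenstein-projective; and $M$ is *torsionless* if it is isomorphic to a submodule of a projective module. Let $\operatorname{add}(A)$ be the class of direct summands of finite direct sums of copies of ${}_AA$. A *left $\operatorname{add}(A)$-approximation* of an $A$-module $Y$ is an $A$-homomorphism $\varphi:Y\to P$ with $P\in\operatorname{add}(A)$ such that every $A$-homomorphism from $Y$ to a module in $\operatorname{add}(A)$ factors through $\varphi$. Let $T_2(A)=\begin{pmatrix}A&A\\0&A\end{pmatrix}$. For an $A$-homomorphism $\varphi:Y\to X$, let $\binom{X}{Y}_\varphi$ be the left $T_2(A)$-module $X\oplus Y$ with $\begin{pmatrix}a&b\\0&d\end{pmatrix}\binom{x}{y}=\binom{ax+b\varphi(y)}{dy}$.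 It is called *monic* if $\varphi$ is injective. **Theorem.** Let $Y$ be a double semi-Gorenstein-projective $A$-module which is not torsionless, and let $\varphi:Y\to P$ be a left $\operatorname{add}(A)$-approximation of $Y$. Then $\binom{P}{Y}_\varphi$ is a double semi-Gorenstein-projective $T_2(A)$-module which is not monic. In particular, $\binom{P}{Y}_\varphi$ is not torsionless. -/

import Mathlib

open CategoryTheory

universe u

section Homological

variable (A : Type u) [Ring A] (M : Type u) [AddCommGroup M] [Module A M]

/-- A left `A`-module `M` is semi-Gorenstein-projective if it is finitely generated and
`Ext_A^i(M, A) = 0` for all `i ≥ 1`. -/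
def IsSemiGorensteinProjective : Prop :=
  Module.Finite A M ∧
    ∀ i : ℕ, 1 ≤ i → Subsingleton (Abelian.Ext (ModuleCat.of A M) (ModuleCat.of A A) i)

/-- `M` is double semi-Gorenstein-projective if both `M` and its `A`-dual `M^* = Hom_A(M, A)` are
semi-Gorenstein-projective. The dual is a right `A`-module by `(f a)(m) = f(m) a`, that is, a left
module over the opposite ring. -/
def IsDoubleSemiGorensteinProjective : Prop :=
  IsSemiGorensteinProjective A M ∧ IsSemiGorensteinProjective Aᵐᵒᵖ (Module.Dual A M)

/-- `M` is torsionless if it is isomorphic to a submodule of a (finitely generated) projective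
module. -/
def IsTorsionlessModule : Prop :=
  ∃ (Q : Type u) (_ : AddCommGroup Q) (_ : Module A Q) (f : M →ₗ[A] Q),
    Module.Finite A Q ∧ Module.Projective A Q ∧ Function.Injective f

/-- `M` belongs to `add(A)`: it is a direct summand of a finite direct sum of copies of the
regular module `A`. -/
def IsInAdd : Prop :=
  ∃ (n : ℕ) (s : M →ₗ[A] (Fin n → A)) (r : (Fin n → A) →ₗ[A] M), r ∘ₗ s = LinearMap.id

end Homological

/-- `φ : Y → P` is a left `add(A)`-approximation of `Y`: `P` is in `add(A)` and each map from `Y`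
to a module in `add(A)` factors through `φ`. -/
def IsLeftAddApproximation {A : Type u} [Ring A] {Y P : Type u} [AddCommGroup Y] [Module A Y]
    [AddCommGroup P] [Module A P] (φ : Y →ₗ[A] P) : Prop :=
  IsInAdd A P ∧
    ∀ (Q : Type u) [AddCommGroup Q] [Module A Q], IsInAdd A Q →
      ∀ f : Y →ₗ[A] Q, ∃ g : P →ₗ[A] Q, g ∘ₗ φ = f

/-- The ring `T_2(A)` of upper triangular `2 × 2` matrices over `A`. -/
def T2 (A : Type u) [Ring A] : Subring (Matrix (Fin 2) (Fin 2) A) where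
  carrier := {m | m 1 0 = 0}
  mul_mem' := by
    intro a b ha hb
    simp only [Set.mem_ofPred_eq] at *
    simp [Matrix.mul_apply, Fin.sum_univ_two, ha, hb]
  one_mem' := by simp
  add_mem' := by
    intro a b ha hb
    simp only [Set.mem_ofPred_eq] at *
    simp [ha, hb]
  zero_mem' := by simp
  neg_mem' := by
    intro a ha
    simp only [Set.mem_ofPred_eq] at *
    simp [ha]

namespace T2

variable {A : Type u} [Ring A]

/-- The matrix unit `e_{12}`. -/
def e12 : T2 A := ⟨!![0, 1; 0, 0], show (0 : A) = 0 from rfl⟩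

/-- The matrix unit `e_{22}`. -/
def e22 : T2 A := ⟨!![0, 0; 0, 1], show (0 : A) = 0 from rfl⟩

/-- A left `T_2(A)`-module `M` is monic if its structure map `e_{22} M → e_{11} M`,
`m ↦ e_{12} m`, is injective. Under the identification of `T_2(A)`-modules with triples
`(X, Y)_φ` this is the map `φ : Y → X`, see `T2.isMonic_triple`. -/
def IsMonic (M : Type u) [AddCommGroup M] [Module (T2 A) M] : Prop :=
  Set.InjOn (fun m : M => (e12 : T2 A) • m) (Set.range fun m : M => (e22 : T2 A) • m)

variable {X Y : Type u} [AddCommGroup X] [Module A X] [AddCommGroup Y] [Module A Y]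

/-- The underlying group `X × Y` of the `T_2(A)`-module `(X, Y)_φ` given by an `A`-linear map
`φ : Y → X`. -/
def Triple (_φ : Y →ₗ[A] X) : Type u := X × Y

instance (φ : Y →ₗ[A] X) : AddCommGroup (Triple φ) := inferInstanceAs (AddCommGroup (X × Y))

/-- The `T_2(A)`-module structure of `(X, Y)_φ`: the matrix with rows `(a, b)` and `(0, d)` sends
the column `(x, y)` to `(a x + b φ(y), d y)`. -/
instance (φ : Y →ₗ[A] X) : Module (T2 A) (Triple φ) where
  smul t v := (t.1 0 0 • v.1 + t.1 0 1 • φ v.2, t.1 1 1 • v.2)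
  one_smul v := by
    refine Prod.ext ?_ ?_
    · change (1 : Matrix (Fin 2) (Fin 2) A) 0 0 • v.1
        + (1 : Matrix (Fin 2) (Fin 2) A) 0 1 • φ v.2 = v.1
      simp
    · change (1 : Matrix (Fin 2) (Fin 2) A) 1 1 • v.2 = v.2
      simp
  mul_smul s t v := by
    have hs : s.1 1 0 = 0 := s.2
    have ht : t.1 1 0 = 0 := t.2
    refine Prod.ext ?_ ?_
    · change (s.1 * t.1) 0 0 • v.1 + (s.1 * t.1) 0 1 • φ v.2
        = s.1 0 0 • (t.1 0 0 • v.1 + t.1 0 1 • φ v.2) + s.1 0 1 • φ (t.1 1 1 • v.2)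
      simp [Matrix.mul_apply, Fin.sum_univ_two, ht, add_smul, mul_smul, add_assoc]
    · change (s.1 * t.1) 1 1 • v.2 = s.1 1 1 • t.1 1 1 • v.2
      simp [Matrix.mul_apply, Fin.sum_univ_two, hs, mul_smul]
  smul_zero t := by
    refine Prod.ext ?_ ?_
    · change t.1 0 0 • (0 : X) + t.1 0 1 • φ (0 : Y) = 0
      simp
    · change t.1 1 1 • (0 : Y) = 0
      simp
  smul_add t v w := by
    refine Prod.ext ?_ ?_
    · change t.1 0 0 • (v.1 + w.1) + t.1 0 1 • φ (v.2 + w.2)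
        = (t.1 0 0 • v.1 + t.1 0 1 • φ v.2) + (t.1 0 0 • w.1 + t.1 0 1 • φ w.2)
      simp only [smul_add, map_add]
      abel
    · change t.1 1 1 • (v.2 + w.2) = t.1 1 1 • v.2 + t.1 1 1 • w.2
      rw [smul_add]
  add_smul s t v := by
    refine Prod.ext ?_ ?_
    · change (s.1 + t.1) 0 0 • v.1 + (s.1 + t.1) 0 1 • φ v.2
        = (s.1 0 0 • v.1 + s.1 0 1 • φ v.2) + (t.1 0 0 • v.1 + t.1 0 1 • φ v.2)
      simp only [Matrix.add_apply, add_smul]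
      abel
    · change (s.1 + t.1) 1 1 • v.2 = s.1 1 1 • v.2 + t.1 1 1 • v.2
      rw [Matrix.add_apply, add_smul]
  zero_smul v := by
    refine Prod.ext ?_ ?_
    · change (0 : Matrix (Fin 2) (Fin 2) A) 0 0 • v.1
        + (0 : Matrix (Fin 2) (Fin 2) A) 0 1 • φ v.2 = 0
      simp
    · change (0 : Matrix (Fin 2) (Fin 2) A) 1 1 • v.2 = 0
      simp

/-- The element of `(X, Y)_φ` with components `x` and `y`. -/
def Triple.mk (φ : Y →ₗ[A] X) (x : X) (y : Y) : Triple φ := (x, y)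

theorem smul_mk (φ : Y →ₗ[A] X) (t : T2 A) (x : X) (y : Y) :
    t • Triple.mk φ x y = Triple.mk φ (t.1 0 0 • x + t.1 0 1 • φ y) (t.1 1 1 • y) := rfl

/-- The module `(X, Y)_φ` is monic if and only if `φ` is a monomorphism. -/
theorem isMonic_triple (φ : Y →ₗ[A] X) :
    IsMonic (A := A) (Triple φ) ↔ Function.Injective φ := by
  have h22 : ∀ (x : X) (y : Y), (e22 : T2 A) • Triple.mk φ x y = Triple.mk φ 0 y := by
    intro x y
    rw [smul_mk]
    simp [e22]
  have h12 : ∀ (x : X) (y : Y), (e12 : T2 A) • Triple.mk φ x y = Triple.mk φ (φ y) 0 := by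
    intro x y
    rw [smul_mk]
    simp [e12]
  constructor
  · intro h y y' hy
    have key : Triple.mk φ 0 y = Triple.mk φ 0 y' := by
      refine h ⟨Triple.mk φ 0 y, h22 0 y⟩ ⟨Triple.mk φ 0 y', h22 0 y'⟩ ?_
      change (e12 : T2 A) • Triple.mk φ 0 y = (e12 : T2 A) • Triple.mk φ 0 y'
      rw [h12, h12, hy]
    exact congrArg Prod.snd key
  · rintro h _ ⟨v, rfl⟩ _ ⟨w, rfl⟩ hvw
    obtain ⟨x, y, rfl⟩ : ∃ x y, v = Triple.mk φ x y := ⟨v.1, v.2, rfl⟩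
    obtain ⟨x', y', rfl⟩ : ∃ x y, w = Triple.mk φ x y := ⟨w.1, w.2, rfl⟩
    change (e12 : T2 A) • (e22 : T2 A) • Triple.mk φ x y
      = (e12 : T2 A) • (e22 : T2 A) • Triple.mk φ x' y' at hvw
    change (e22 : T2 A) • Triple.mk φ x y = (e22 : T2 A) • Triple.mk φ x' y'
    rw [h22, h22, h12, h12] at hvw
    rw [h22, h22, h (congrArg Prod.fst hvw)]

end T2

/-! Everything rests on one criterion (`T2.Triple.isSemiGorensteinProjective`), used over `A` and
over `Aᵐᵒᵖ`: if `X`, `Y` are semi-Gorenstein-projective and every map `Y → A` extends along `φ`,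
then so is `(X, Y)_φ`. It is proved by covering with projective triples `(F × G, G)`, whose kernels
are triples satisfying the same hypotheses, so that only `Ext¹` needs a direct argument.

For `φ : Y → P` the extension condition is the approximation property. It also makes `φ^*`
surjective, and the dual of `(P, Y)_φ` is the triple `Ker φ^* ⊆ P^*` over `Aᵐᵒᵖ`. From `0 → Ker φ^*
→ P^* → Y^* → 0` with `P^*` projective, the vanishing of `Ext^i(Y^*, A)` gives the criterion for
this triple.

If `φ` were injective, `Y` would embed in `P`; and torsionless `T_2(A)`-modules are monic because
free ones are. -/

section DimensionShift

/-! ### Dimension shifting along a projective middle term. -/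

variable {S : Type u} [Ring S] {K F M N : Type u} [AddCommGroup K] [Module S K]
  [AddCommGroup F] [Module S F] [AddCommGroup M] [Module S M] [AddCommGroup N] [Module S N]

theorem subsingleton_ext_of_projective [Module.Projective S M] {i : ℕ} (hi : 1 ≤ i) :
    Subsingleton (Abelian.Ext (ModuleCat.of S M) (ModuleCat.of S N) i) := by
  obtain ⟨j, rfl⟩ := Nat.exists_eq_add_of_le' hi
  have : Projective (ModuleCat.of S M) := (IsProjective.iff_projective M).1 inferInstance
  exact Abelian.Ext.subsingleton_of_projective _ _ _

/-- The short exact sequence in `ModuleCat S` given by an exact pair of linear maps. -/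
abbrev shortComplexOfExact (f : K →ₗ[S] F) (g : F →ₗ[S] M) (h : Function.Exact f g) :
    ShortComplex (ModuleCat.{u} S) :=
  ShortComplex.mk (ModuleCat.ofHom f) (ModuleCat.ofHom g)
    (by rw [← ModuleCat.ofHom_comp, h.linearMap_comp_eq_zero]; rfl)

variable {f : K →ₗ[S] F} {g : F →ₗ[S] M}

theorem shortExact_shortComplexOfExact (h : Function.Exact f g) (hf : Function.Injective f)
    (hg : Function.Surjective g) : (shortComplexOfExact f g h).ShortExact :=
  ModuleCat.shortComplex_shortExact _ h hf hg

variable [Module.Projective S F]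

/-- Since `Ext¹(F, N) = 0`, the group `Ext¹(M, N)` is the cokernel of restriction `Hom(F, N) →
Hom(K, N)`. -/
theorem subsingleton_ext_one_iff (h : Function.Exact f g) (hf : Function.Injective f)
    (hg : Function.Surjective g) :
    Subsingleton (Abelian.Ext (ModuleCat.of S M) (ModuleCat.of S N) 1) ↔
      ∀ k : K →ₗ[S] N, ∃ l : F →ₗ[S] N, l ∘ₗ f = k := by
  have hS := shortExact_shortComplexOfExact h hf hg
  constructor
  · intro _ k
    obtain ⟨x, hx⟩ := Abelian.Ext.contravariant_sequence_exact₁ hS (ModuleCat.of S N)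
      (Abelian.Ext.mk₀ (ModuleCat.ofHom k)) (add_zero 1)
      (Subsingleton.elim (α := Abelian.Ext (ModuleCat.of S M) (ModuleCat.of S N) 1) _ _)
    obtain ⟨l, rfl⟩ := (Abelian.Ext.mk₀_bijective _ _).2 x
    rw [Abelian.Ext.mk₀_comp_mk₀] at hx
    have := (Abelian.Ext.mk₀_bijective _ _).1 hx
    exact ⟨l.hom, congrArg ModuleCat.Hom.hom this⟩
  · intro H
    refine subsingleton_of_forall_eq 0 fun x => ?_
    obtain ⟨y, hy⟩ := Abelian.Ext.contravariant_sequence_exact₃ hS (ModuleCat.of S N) x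
      ((subsingleton_ext_of_projective (M := F) le_rfl).elim _ _) (add_zero 1)
    obtain ⟨k, rfl⟩ := (Abelian.Ext.mk₀_bijective _ _).2 y
    obtain ⟨l, hl⟩ := H k.hom
    have : k = (shortComplexOfExact f g h).f ≫ ModuleCat.ofHom l := by
      ext x
      exact (LinearMap.congr_fun hl x).symm
    rw [← hy, this, ← Abelian.Ext.mk₀_comp_mk₀, hS.extClass_comp_assoc]

theorem subsingleton_ext_succ_iff (h : Function.Exact f g) (hf : Function.Injective f)
    (hg : Function.Surjective g) {i : ℕ} (hi : 1 ≤ i) :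
    Subsingleton (Abelian.Ext (ModuleCat.of S M) (ModuleCat.of S N) (i + 1)) ↔
      Subsingleton (Abelian.Ext (ModuleCat.of S K) (ModuleCat.of S N) i) := by
  have hS := shortExact_shortComplexOfExact h hf hg
  constructor
  · intro _
    refine subsingleton_of_forall_eq 0 fun x => ?_
    obtain ⟨y, rfl⟩ := Abelian.Ext.contravariant_sequence_exact₁ hS (ModuleCat.of S N) x
      (add_comm 1 i)
      (Subsingleton.elim (α := Abelian.Ext (ModuleCat.of S M) (ModuleCat.of S N) (i + 1)) _ _)
    rw [(subsingleton_ext_of_projective (M := F) hi).elim y 0, Abelian.Ext.comp_zero]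
  · intro _
    refine subsingleton_of_forall_eq 0 fun x => ?_
    obtain ⟨y, rfl⟩ := Abelian.Ext.contravariant_sequence_exact₃ hS (ModuleCat.of S N) x
      ((subsingleton_ext_of_projective (M := F) (Nat.le_add_left 1 i)).elim _ _) (add_comm 1 i)
    rw [Subsingleton.elim (α := Abelian.Ext (ModuleCat.of S K) (ModuleCat.of S N) i) y 0,
      Abelian.Ext.comp_zero]

end DimensionShift

/-! ### Change of rings along an isomorphism. -/

section RingEquiv

variable {S S' : Type u} [Ring S] [Ring S'] (e : S ≃+* S')

/-- Vanishing of `Ext` is invariant under semilinear equivalences over a ring isomorphism. -/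
theorem subsingleton_ext_of_ringEquiv {M N M' N' : Type u} [AddCommGroup M] [Module S M]
    [AddCommGroup N] [Module S N] [AddCommGroup M'] [Module S' M'] [AddCommGroup N'] [Module S' N']
    (f : M ≃+ M') (hf : ∀ (s : S) (m : M), f (s • m) = e s • f m)
    (g : N ≃+ N') (hg : ∀ (s : S) (n : N), g (s • n) = e s • g n) {i : ℕ}
    (h : Subsingleton (Abelian.Ext (ModuleCat.of S' M') (ModuleCat.of S' N') i)) :
    Subsingleton (Abelian.Ext (ModuleCat.of S M) (ModuleCat.of S N) i) := by
  let : Module S M' := Module.compHom M' e.toRingHom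
  let : Module S N' := Module.compHom N' e.toRingHom
  -- Restriction along `e` is exact and preserves projectives, and it induces bijections on `Ext`.
  have h1 : Subsingleton (Abelian.Ext (ModuleCat.of S M') (ModuleCat.of S N') i) :=
    ((ModuleCat.restrictScalars.{u} e.toRingHom).mapExt_bijective_of_preservesProjectiveObjects
      (ModuleCat.of S' M') (ModuleCat.of S' N') i).2.subsingleton
  let iM : ModuleCat.of S M ≅ ModuleCat.of S M' :=
    LinearEquiv.toModuleIso { f with map_smul' := hf }
  let iN : ModuleCat.of S N ≅ ModuleCat.of S N' :=
    LinearEquiv.toModuleIso { g with map_smul' := hg }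
  refine subsingleton_of_forall_eq 0 fun x => ?_
  have hx : (Abelian.Ext.mk₀ iM.hom).comp
      (((Abelian.Ext.mk₀ iM.inv).comp x (zero_add i)).comp (Abelian.Ext.mk₀ iN.hom) (add_zero i))
      (zero_add i) = x.comp (Abelian.Ext.mk₀ iN.hom) (add_zero i) := by
    rw [← Abelian.Ext.comp_assoc_of_third_deg_zero, ← Abelian.Ext.comp_assoc_of_second_deg_zero]
    simp
  have hx' : x = (x.comp (Abelian.Ext.mk₀ iN.hom) (add_zero i)).comp (Abelian.Ext.mk₀ iN.inv)
      (add_zero i) := by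
    rw [Abelian.Ext.comp_assoc_of_third_deg_zero]
    simp
  rw [hx', ← hx, h1.elim ((_ : Abelian.Ext _ _ i).comp _ _) 0]
  simp

end RingEquiv

/-! ### Triples, their maps to the regular module, and the criterion. -/

namespace T2

variable {A : Type u} [Ring A] {X Y : Type u} [AddCommGroup X] [Module A X] [AddCommGroup Y]
  [Module A Y] {X' Y' : Type u} [AddCommGroup X'] [Module A X'] [AddCommGroup Y'] [Module A Y']

/-- The upper triangular matrix with rows `(a, b)` and `(0, d)`. -/
def of (a b d : A) : T2 A := ⟨!![a, b; 0, d], show (0 : A) = 0 from rfl⟩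

@[simp] theorem of_apply_zero_zero (a b d : A) : (of a b d).1 0 0 = a := rfl
@[simp] theorem of_apply_zero_one (a b d : A) : (of a b d).1 0 1 = b := rfl
@[simp] theorem of_apply_one_one (a b d : A) : (of a b d).1 1 1 = d := rfl

@[ext] theorem ext {s t : T2 A} (h₀ : s.1 0 0 = t.1 0 0) (h₁ : s.1 0 1 = t.1 0 1)
    (h₂ : s.1 1 1 = t.1 1 1) : s = t := by
  refine Subtype.ext (Matrix.ext fun i j => ?_)
  fin_cases i <;> fin_cases j
  · exact h₀
  · exact h₁
  · exact (show s.1 1 0 = 0 from s.2).trans (show t.1 1 0 = 0 from t.2).symm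
  · exact h₂

@[simp] theorem add_apply (s t : T2 A) (i j : Fin 2) : (s + t).1 i j = s.1 i j + t.1 i j := rfl
@[simp] theorem zero_apply (i j : Fin 2) : (0 : T2 A).1 i j = 0 := rfl

@[simp] theorem mul_apply_zero_zero (s t : T2 A) : (s * t).1 0 0 = s.1 0 0 * t.1 0 0 := by
  have ht : t.1 1 0 = 0 := t.2
  change (s.1 * t.1) 0 0 = _
  simp [Matrix.mul_apply, Fin.sum_univ_two, ht]

@[simp] theorem mul_apply_zero_one (s t : T2 A) :
    (s * t).1 0 1 = s.1 0 0 * t.1 0 1 + s.1 0 1 * t.1 1 1 := by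
  change (s.1 * t.1) 0 1 = _
  simp [Matrix.mul_apply, Fin.sum_univ_two]

@[simp] theorem mul_apply_one_one (s t : T2 A) : (s * t).1 1 1 = s.1 1 1 * t.1 1 1 := by
  have hs : s.1 1 0 = 0 := s.2
  change (s.1 * t.1) 1 1 = _
  simp [Matrix.mul_apply, Fin.sum_univ_two, hs]

namespace Triple

theorem mk_add (φ : Y →ₗ[A] X) (x x' : X) (y y' : Y) :
    mk φ (x + x') (y + y') = mk φ x y + mk φ x' y' := rfl

/-- The morphism `(X, Y)_φ → (X', Y')_ψ` given by a commutative square. -/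
def map {φ : Y →ₗ[A] X} {ψ : Y' →ₗ[A] X'} (f : X →ₗ[A] X') (g : Y →ₗ[A] Y')
    (h : f ∘ₗ φ = ψ ∘ₗ g) : Triple φ →ₗ[T2 A] Triple ψ where
  toFun v := mk ψ (f v.1) (g v.2)
  map_add' v w := by
    rw [← mk_add, ← map_add, ← map_add]
    rfl
  map_smul' t v := by
    change mk ψ (f (t.1 0 0 • v.1 + t.1 0 1 • φ v.2)) (g (t.1 1 1 • v.2)) = _
    have := LinearMap.congr_fun h v.2
    simp only [LinearMap.comp_apply] at this
    rw [RingHom.id_apply, smul_mk, map_add, map_smul, map_smul, map_smul, this]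

/-- Morphisms `(X, Y)_φ → T_2(A)` are pairs of maps `α β : X → A` with `α φ = 0`. -/
def homOfPair {φ : Y →ₗ[A] X} (α β : X →ₗ[A] A) (h : α ∘ₗ φ = 0) : Triple φ →ₗ[T2 A] T2 A where
  toFun v := of (α v.1) (β v.1) (β (φ v.2))
  map_add' v w := by
    change of (α (v.1 + w.1)) (β (v.1 + w.1)) (β (φ (v.2 + w.2))) = _
    ext <;> simp
  map_smul' t v := by
    have := LinearMap.congr_fun h v.2
    change of (α (t.1 0 0 • v.1 + t.1 0 1 • φ v.2)) (β (t.1 0 0 • v.1 + t.1 0 1 • φ v.2))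
      (β (φ (t.1 1 1 • v.2))) = _
    ext <;> simp
    rw [← LinearMap.comp_apply, h]; simp

theorem homOfPair_mk {φ : Y →ₗ[A] X} (α β : X →ₗ[A] A) (h : α ∘ₗ φ = 0) (x : X) (y : Y) :
    homOfPair α β h (mk φ x y) = of (α x) (β x) (β (φ y)) := rfl

section components

variable {φ : Y →ₗ[A] X} (f : Triple φ →ₗ[T2 A] T2 A)

theorem smul_mk_left (a : A) (x : X) : mk φ (a • x) 0 = of a 0 0 • mk φ x 0 := by
  rw [smul_mk]; simp

/-- The idempotent `of 1 0 0` fixes `(x, 0)`, so it fixes the image, which therefore lies in the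
first row. The next two lemmas use `of 0 0 1` in the same way. -/
theorem hom_mk_apply_one_one (x : X) : (f (mk φ x 0)).1 1 1 = 0 := by
  have : f (mk φ x 0) = of 1 0 0 * f (mk φ x 0) := by
    rw [← smul_eq_mul, ← map_smul, ← smul_mk_left, one_smul]
  rw [this]; simp

theorem hom_mk_apply_zero_zero (y : Y) : (f (mk φ 0 y)).1 0 0 = 0 := by
  have : f (mk φ 0 y) = of 0 0 1 * f (mk φ 0 y) := by
    rw [← smul_eq_mul, ← map_smul, smul_mk]; simp
  rw [this]; simp

theorem hom_mk_apply_zero_one (y : Y) : (f (mk φ 0 y)).1 0 1 = 0 := by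
  have : f (mk φ 0 y) = of 0 0 1 * f (mk φ 0 y) := by
    rw [← smul_eq_mul, ← map_smul, smul_mk]; simp
  rw [this]; simp

theorem hom_mk_map (y : Y) : f (mk φ (φ y) 0) = of 0 1 0 * f (mk φ 0 y) := by
  rw [← smul_eq_mul, ← map_smul, smul_mk]; simp

/-- The first row, first column component of a morphism `(X, Y)_φ → T_2(A)`. -/
def fstComponent : X →ₗ[A] A where
  toFun x := (f (mk φ x 0)).1 0 0
  map_add' x x' := by
    rw [← add_apply, ← map_add, ← mk_add, add_zero]
  map_smul' a x := by
    rw [smul_mk_left, map_smul]; simp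

/-- The first row, second column component of a morphism `(X, Y)_φ → T_2(A)`. -/
def sndComponent : X →ₗ[A] A where
  toFun x := (f (mk φ x 0)).1 0 1
  map_add' x x' := by
    rw [← add_apply, ← map_add, ← mk_add, add_zero]
  map_smul' a x := by
    rw [smul_mk_left, map_smul]; simp

theorem fstComponent_comp : fstComponent f ∘ₗ φ = 0 := by
  ext y
  change (f (mk φ (φ y) 0)).1 0 0 = 0
  rw [hom_mk_map, mul_apply_zero_zero]; simp

/-- Multiplication by `of 0 1 0` carries `(0, y)` to `(φ y, 0)`, which forces the lower right entry
at `y` to be the second component at `φ y`. -/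
theorem homOfPair_components :
    homOfPair (fstComponent f) (sndComponent f) (fstComponent_comp f) = f := by
  refine LinearMap.ext fun v => ?_
  obtain ⟨x, y, rfl⟩ : ∃ x y, v = mk φ x y := ⟨v.1, v.2, rfl⟩
  have hv : f (mk φ x y) = f (mk φ x 0) + f (mk φ 0 y) := by
    rw [← map_add, ← mk_add, add_zero, zero_add]
  have hy : sndComponent f (φ y) = (f (mk φ 0 y)).1 1 1 := by
    change (f (mk φ (φ y) 0)).1 0 1 = _
    rw [hom_mk_map, mul_apply_zero_one]; simp
  rw [homOfPair_mk, hv, hy]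
  ext
  · simp [hom_mk_apply_zero_zero, fstComponent]
  · simp [hom_mk_apply_zero_one, sndComponent]
  · simp [hom_mk_apply_one_one]

end components

section cover

variable (A) (ι κ : Type u)

/-- The inclusion of the second summand, whose triple is a projective `T_2(A)`-module. -/
noncomputable abbrev inclusion : (κ →₀ A) →ₗ[A] (ι →₀ A) × (κ →₀ A) := LinearMap.inr A _ _

variable {A ι} in
/-- The entrywise projection `F ⊗ T_2(A) → F` of a free module. -/
noncomputable def entry (i j : Fin 2) (w : ι →₀ T2 A) : ι →₀ A :=
  w.mapRange (fun t => t.1 i j) (zero_apply i j)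

variable {A ι} in
@[simp] theorem entry_apply (i j : Fin 2) (w : ι →₀ T2 A) (k : ι) :
    entry i j w k = (w k).1 i j := rfl

/-- The projection from a free `T_2(A)`-module onto `(F × G, G)`, for `F`, `G` free. -/
noncomputable def projOfFree : ((ι →₀ T2 A) × (κ →₀ T2 A)) →ₗ[T2 A] Triple (inclusion A ι κ) where
  toFun w := mk _ (entry 0 0 w.1, entry 0 1 w.2) (entry 1 1 w.2)
  map_add' w w' := by
    rw [← mk_add]
    congr 1
    · refine Prod.ext ?_ ?_ <;> ext <;> simp
    · ext; simp
  map_smul' t w := by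
    rw [RingHom.id_apply, smul_mk]
    congr 1
    · refine Prod.ext ?_ ?_ <;> ext <;> simp
    · ext; simp

/-- A section of `T2.Triple.projOfFree`. -/
noncomputable def toFree : Triple (inclusion A ι κ) →ₗ[T2 A] ((ι →₀ T2 A) × (κ →₀ T2 A)) where
  toFun v := (v.1.1.mapRange (fun a => of a 0 0) (by ext <;> rfl),
    v.1.2.mapRange (fun b => of 0 b 0) (by ext <;> rfl) +
      v.2.mapRange (fun d => of 0 0 d) (by ext <;> rfl))
  map_add' v w := by
    obtain ⟨x, y, rfl⟩ : ∃ x y, v = mk _ x y := ⟨v.1, v.2, rfl⟩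
    obtain ⟨x', y', rfl⟩ : ∃ x y, w = mk _ x y := ⟨w.1, w.2, rfl⟩
    rw [← mk_add]
    refine Prod.ext ?_ ?_ <;> refine Finsupp.ext fun i => ?_ <;> ext <;> simp [mk]
  map_smul' t v := by
    obtain ⟨x, y, rfl⟩ : ∃ x y, v = mk _ x y := ⟨v.1, v.2, rfl⟩
    rw [smul_mk]
    refine Prod.ext ?_ ?_ <;> refine Finsupp.ext fun i => ?_ <;> ext <;> simp [mk]

/-- The columns of `T_2(A)` are the triples `(A, 0)` and `(A, A)_id`; `(F × G, G)` is a sum of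
copies of these, hence a summand of a free module. -/
theorem projOfFree_comp_toFree : projOfFree A ι κ ∘ₗ toFree A ι κ = LinearMap.id := by
  refine LinearMap.ext fun v => ?_
  refine Prod.ext (Prod.ext ?_ ?_) ?_ <;> refine Finsupp.ext fun i => ?_
  · change (entry 0 0 (toFree A ι κ v).1) i = _
    simp [toFree]
  · change (entry 0 1 (toFree A ι κ v).2) i = _
    simp [toFree]
  · change (entry 1 1 (toFree A ι κ v).2) i = _
    simp [toFree]

instance : Module.Projective (T2 A) (Triple (inclusion A ι κ)) :=
  Module.Projective.of_split _ _ (projOfFree_comp_toFree A ι κ)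

instance [Finite ι] [Finite κ] : Module.Finite (T2 A) (Triple (inclusion A ι κ)) :=
  Module.Finite.of_surjective (projOfFree A ι κ) fun v =>
    ⟨toFree A ι κ v, LinearMap.congr_fun (projOfFree_comp_toFree A ι κ) v⟩

variable {A ι κ} (φ : Y →ₗ[A] X) (p : (ι →₀ A) →ₗ[A] X) (q : (κ →₀ A) →ₗ[A] Y)

/-- The cover of `(X, Y)_φ` by `(F × G, G)` for maps `F → X` and `G → Y`. -/
noncomputable def cover : Triple (inclusion A ι κ) →ₗ[T2 A] Triple φ :=
  map (p.coprod (φ ∘ₗ q)) q (LinearMap.coprod_inr _ _)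

theorem cover_surjective {p : (ι →₀ A) →ₗ[A] X} {q : (κ →₀ A) →ₗ[A] Y}
    (hp : Function.Surjective p) (hq : Function.Surjective q) :
    Function.Surjective (cover φ p q) := by
  intro v
  obtain ⟨b, hb⟩ := hq v.2
  obtain ⟨a, ha⟩ := hp (v.1 - φ v.2)
  refine ⟨mk _ (a, b) b, Prod.ext ?_ hb⟩
  change p.coprod (φ ∘ₗ q) (a, b) = v.1
  simp [ha, hb]

/-- The structure map of the kernel of `T2.Triple.cover`. -/
noncomputable def kerMap : LinearMap.ker q →ₗ[A] LinearMap.ker (p.coprod (φ ∘ₗ q)) :=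
  (inclusion A ι κ).restrict fun g (hg : q g = 0) => by simp [hg]

/-- The kernel of `T2.Triple.cover`. -/
abbrev Ker : Type u :=
  Triple (A := A) (X := LinearMap.ker (p.coprod (φ ∘ₗ q))) (Y := LinearMap.ker q) (kerMap φ p q)

/-- The inclusion of the kernel of `T2.Triple.cover`. -/
noncomputable def kerInclusion : Ker φ p q →ₗ[T2 A] Triple (inclusion A ι κ) :=
  map (LinearMap.ker (p.coprod (φ ∘ₗ q))).subtype (LinearMap.ker q).subtype rfl

theorem kerInclusion_injective : Function.Injective (kerInclusion φ p q) := by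
  intro v w h
  exact Prod.ext (Subtype.ext (congrArg Prod.fst h)) (Subtype.ext (congrArg Prod.snd h))

theorem exact_kerInclusion_cover : Function.Exact (kerInclusion φ p q) (cover φ p q) := by
  intro v
  constructor
  · intro h
    exact ⟨mk _ ⟨v.1, congrArg Prod.fst h⟩ ⟨v.2, congrArg Prod.snd h⟩, rfl⟩
  · rintro ⟨w, rfl⟩
    exact Prod.ext w.1.2 w.2.2

end cover

instance finite (φ : Y →ₗ[A] X) [Module.Finite A X] [Module.Finite A Y] :
    Module.Finite (T2 A) (Triple φ) := by
  obtain ⟨n, p, hp⟩ := Module.Finite.exists_fin' A X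
  obtain ⟨m, q, hq⟩ := Module.Finite.exists_fin' A Y
  -- `ULift` places the finite index types in the universe required by `cover`.
  let en (k : ℕ) : (ULift.{u} (Fin k) →₀ A) ≃ₗ[A] (Fin k → A) :=
    (Finsupp.domLCongr Equiv.ulift).trans (Finsupp.linearEquivFunOnFinite A A (Fin k))
  exact Module.Finite.of_surjective _ (cover_surjective φ
    (p := p ∘ₗ (en n).toLinearMap) (q := q ∘ₗ (en m).toLinearMap)
    (hp.comp (en n).surjective) (hq.comp (en m).surjective))

/-- Both components of `f` extend to `α`, `β` on `F × G`, but `α` need not vanish on `G` as a map of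
triples requires. On `G` it kills `Ker q`, hence factors through `Y`, and then through `φ` by some
`l : X → A`. Subtracting `l` composed with the cover repairs `α` without changing it on the kernel.
-/
theorem exists_comp_kerInclusion_eq (φ : Y →ₗ[A] X) {ι κ : Type u} {p : (ι →₀ A) →ₗ[A] X}
    {q : (κ →₀ A) →ₗ[A] Y} (hq : Function.Surjective q)
    (hX : ∀ k : LinearMap.ker (p.coprod (φ ∘ₗ q)) →ₗ[A] A, ∃ l : (ι →₀ A) × (κ →₀ A) →ₗ[A] A,
      l ∘ₗ (LinearMap.ker (p.coprod (φ ∘ₗ q))).subtype = k)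
    (hφ : ∀ k : Y →ₗ[A] A, ∃ l : X →ₗ[A] A, l ∘ₗ φ = k)
    (f : Ker φ p q →ₗ[T2 A] T2 A) :
    ∃ g : Triple (inclusion A ι κ) →ₗ[T2 A] T2 A, g ∘ₗ kerInclusion φ p q = f := by
  obtain ⟨α, hα⟩ := hX (fstComponent f)
  obtain ⟨β, hβ⟩ := hX (sndComponent f)
  have hker : LinearMap.ker q ≤ LinearMap.ker (α ∘ₗ inclusion A ι κ) := by
    intro y hy
    have h1 := LinearMap.congr_fun (fstComponent_comp f) ⟨y, hy⟩
    rw [← hα] at h1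
    exact h1
  obtain ⟨k, hk⟩ : ∃ k : Y →ₗ[A] A, k ∘ₗ q = α ∘ₗ inclusion A ι κ := by
    refine ⟨(LinearMap.ker q).liftQ _ hker ∘ₗ
      (q.quotKerEquivOfSurjective hq).symm.toLinearMap, ?_⟩
    ext1 i
    ext
    simp only [LinearMap.comp_apply, LinearEquiv.coe_coe]
    rw [← LinearMap.quotKerEquivOfSurjective_apply_mk q hq, LinearEquiv.symm_apply_apply,
      Submodule.liftQ_apply]
    rfl
  obtain ⟨l, hl⟩ := hφ k
  have hα' : (α - l ∘ₗ p.coprod (φ ∘ₗ q)) ∘ₗ inclusion A ι κ = 0 := by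
    rw [LinearMap.sub_comp, LinearMap.comp_assoc, LinearMap.coprod_inr, ← LinearMap.comp_assoc,
      hl, hk, sub_self]
  refine ⟨homOfPair _ β hα', ?_⟩
  rw [← homOfPair_components f]
  refine LinearMap.ext fun v => ?_
  have hvα := LinearMap.congr_fun hα v.1
  have hvβ := LinearMap.congr_fun hβ v.1
  -- The lower right entry is the second component evaluated after the structure map.
  have hvβ' := LinearMap.congr_fun hβ (kerMap φ p q v.2)
  have hv : p.coprod (φ ∘ₗ q) v.1.1 = 0 := v.1.2
  refine T2.ext ?_ hvβ hvβ'
  change α v.1.1 - l (p.coprod (φ ∘ₗ q) v.1.1) = _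
  rw [hv, map_zero, sub_zero]
  exact hvα

theorem coprod_surjective_of_left {M₁ M₂ M₃ : Type*} [AddCommGroup M₁] [Module A M₁]
    [AddCommGroup M₂] [Module A M₂] [AddCommGroup M₃] [Module A M₃] {p : M₁ →ₗ[A] M₃}
    (hp : Function.Surjective p) (q : M₂ →ₗ[A] M₃) : Function.Surjective (p.coprod q) := fun x =>
  let ⟨a, ha⟩ := hp x
  ⟨(a, 0), by simpa using ha⟩

/-- Induction on the degree, for all triples at once, since the step replaces a triple by the kernel
of its cover. -/
theorem subsingleton_ext_succ (i : ℕ) : ∀ {X Y : Type u} [AddCommGroup X] [Module A X]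
    [AddCommGroup Y] [Module A Y] (φ : Y →ₗ[A] X)
    (_ : ∀ i : ℕ, 1 ≤ i → Subsingleton (Abelian.Ext (ModuleCat.of A X) (ModuleCat.of A A) i))
    (_ : ∀ i : ℕ, 1 ≤ i → Subsingleton (Abelian.Ext (ModuleCat.of A Y) (ModuleCat.of A A) i))
    (_ : ∀ k : Y →ₗ[A] A, ∃ l : X →ₗ[A] A, l ∘ₗ φ = k),
    Subsingleton (Abelian.Ext (ModuleCat.of (T2 A) (Triple φ)) (ModuleCat.of (T2 A) (T2 A))
      (i + 1)) := by
  induction i with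
  | zero =>
    intro X Y _ _ _ _ φ hX hY hφ
    have hp := Finsupp.linearCombination_id_surjective A X
    have hq := Finsupp.linearCombination_id_surjective A Y
    refine (subsingleton_ext_one_iff (exact_kerInclusion_cover φ _ _)
      (kerInclusion_injective φ _ _) (cover_surjective φ hp hq)).2 ?_
    refine exists_comp_kerInclusion_eq φ hq ?_ hφ
    exact (subsingleton_ext_one_iff (LinearMap.exact_subtype_ker_map _)
      (Submodule.subtype_injective _) (coprod_surjective_of_left hp _)).1 (hX 1 le_rfl)
  | succ i ih =>
    intro X Y _ _ _ _ φ hX hY hφ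
    have hp := Finsupp.linearCombination_id_surjective A X
    have hq := Finsupp.linearCombination_id_surjective A Y
    refine (subsingleton_ext_succ_iff (exact_kerInclusion_cover φ _ _)
      (kerInclusion_injective φ _ _) (cover_surjective φ hp hq) (Nat.le_add_left 1 i)).2 ?_
    refine ih _ (fun j hj => ?_) (fun j hj => ?_) fun k => ?_
    · exact (subsingleton_ext_succ_iff (LinearMap.exact_subtype_ker_map _)
        (Submodule.subtype_injective _) (coprod_surjective_of_left hp _) hj).1
        (hX _ (Nat.le_add_left 1 j))
    · exact (subsingleton_ext_succ_iff (LinearMap.exact_subtype_ker_map _)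
        (Submodule.subtype_injective _) hq hj).1 (hY _ (Nat.le_add_left 1 j))
    -- `Ext¹(Y, A) = 0` extends `k` from `Ker q` to `G`; projecting `F × G` to `G` then gives the
    -- extension along `kerMap`.
    · obtain ⟨l, hl⟩ := (subsingleton_ext_one_iff (LinearMap.exact_subtype_ker_map _)
        (Submodule.subtype_injective _) hq).1 (hY 1 le_rfl) k
      refine ⟨l ∘ₗ LinearMap.snd A _ _ ∘ₗ Submodule.subtype _, ?_⟩
      rw [← hl]
      rfl

end Triple

end T2

/-! ### Duals of modules in `add(A)`. -/

section Dual

variable {A : Type u} [Ring A] {M N : Type u} [AddCommGroup M] [Module A M]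
  [AddCommGroup N] [Module A N]

/-- The dual `φ^* : N^* → M^*` of an `A`-linear map, as a map of right `A`-modules. -/
def opDualMap (φ : M →ₗ[A] N) : Module.Dual A N →ₗ[Aᵐᵒᵖ] Module.Dual A M where
  toFun f := f ∘ₗ φ
  map_add' _ _ := rfl
  map_smul' _ _ := rfl

theorem IsInAdd.exists_dual_split (h : IsInAdd A M) : ∃ (n : ℕ)
    (r : (Fin n → Aᵐᵒᵖ) →ₗ[Aᵐᵒᵖ] Module.Dual A M) (s : Module.Dual A M →ₗ[Aᵐᵒᵖ] (Fin n → Aᵐᵒᵖ)),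
    r ∘ₗ s = LinearMap.id := by
  obtain ⟨n, s, r, hrs⟩ := h
  refine ⟨n, Fintype.linearCombination Aᵐᵒᵖ fun i => LinearMap.proj i ∘ₗ s,
    { toFun := fun f i => MulOpposite.op (f (r (Pi.single i 1)))
      map_add' := fun _ _ => rfl
      map_smul' := fun _ _ => rfl }, ?_⟩
  ext f m
  -- The dual basis expansion provided by the splitting.
  have hm : m = ∑ i, s m i • r (Pi.single i 1) := by
    conv_lhs => rw [← LinearMap.id_apply (R := A) m, ← hrs, LinearMap.comp_apply,
      pi_eq_sum_univ' (s m), map_sum]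
    exact Finset.sum_congr rfl fun i _ => map_smul r _ _
  conv_rhs => rw [LinearMap.id_apply, hm, map_sum]
  simp [Fintype.linearCombination_apply, LinearMap.sum_apply]

theorem IsInAdd.projective (h : IsInAdd A M) : Module.Projective A M := by
  obtain ⟨n, s, r, hrs⟩ := h
  exact Module.Projective.of_split s r hrs

theorem IsInAdd.finite (h : IsInAdd A M) : Module.Finite A M := by
  obtain ⟨n, s, r, hrs⟩ := h
  exact Module.Finite.of_surjective r fun m => ⟨s m, LinearMap.congr_fun hrs m⟩

theorem IsInAdd.projective_dual (h : IsInAdd A M) : Module.Projective Aᵐᵒᵖ (Module.Dual A M) := by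
  obtain ⟨n, r, s, hrs⟩ := h.exists_dual_split
  exact Module.Projective.of_split s r hrs

theorem IsInAdd.finite_dual (h : IsInAdd A M) : Module.Finite Aᵐᵒᵖ (Module.Dual A M) := by
  obtain ⟨n, r, s, hrs⟩ := h.exists_dual_split
  exact Module.Finite.of_surjective r fun m => ⟨s m, LinearMap.congr_fun hrs m⟩

theorem isInAdd_self : IsInAdd A A :=
  ⟨1, LinearMap.pi fun _ => LinearMap.id, LinearMap.proj 0, rfl⟩

theorem IsLeftAddApproximation.exists_comp_eq {φ : M →ₗ[A] N} (h : IsLeftAddApproximation φ)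
    (k : M →ₗ[A] A) : ∃ l : N →ₗ[A] A, l ∘ₗ φ = k :=
  h.2 A isInAdd_self k

end Dual

/-! ### The dual of a triple, and monic modules. -/

namespace T2

variable {A : Type u} [Ring A] {X Y : Type u} [AddCommGroup X] [Module A X] [AddCommGroup Y]
  [Module A Y]

/-- The opposite of `T_2(A)` is `T_2(A^op)`, by reflection in the antidiagonal. -/
def opEquiv (A : Type u) [Ring A] : (T2 A)ᵐᵒᵖ ≃+* T2 Aᵐᵒᵖ where
  toFun t := of (.op (t.unop.1 1 1)) (.op (t.unop.1 0 1)) (.op (t.unop.1 0 0))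
  invFun t := .op (of (t.1 1 1).unop (t.1 0 1).unop (t.1 0 0).unop)
  left_inv t := MulOpposite.unop_injective (by ext <;> rfl)
  right_inv t := by ext <;> rfl
  map_add' s t := by ext <;> rfl
  map_mul' s t := by
    ext
    · simp
    · simp [add_comm]
    · simp

namespace Triple

/-- The triple over `A^op` given by the inclusion of `Ker φ^*` in `X^*`. -/
abbrev DualTriple (φ : Y →ₗ[A] X) : Type u :=
  Triple (A := Aᵐᵒᵖ) (X := Module.Dual A X) (Y := LinearMap.ker (opDualMap φ))
    (LinearMap.ker (opDualMap φ)).subtype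

/-- The dual of `(X, Y)_φ` is given by the inclusion of `Ker φ^*` in `X^*`. -/
def dualEquiv (φ : Y →ₗ[A] X) : Module.Dual (T2 A) (Triple φ) ≃+ DualTriple φ where
  -- The components swap places: right multiplication by `t` takes the row `(α, β)` to `(α t₀₀, α
  -- t₀₁ + β t₁₁)`, so `β` plays the role of `X` and `α` that of `Y`.
  toFun f := mk _ (sndComponent f) ⟨fstComponent f, fstComponent_comp f⟩
  invFun v := homOfPair v.2.1 v.1 v.2.2
  left_inv f := homOfPair_components f
  right_inv v := by
    refine Prod.ext (LinearMap.ext fun x => ?_) (Subtype.ext (LinearMap.ext fun x => ?_)) <;> rfl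
  map_add' f g := by
    refine Prod.ext (LinearMap.ext fun x => ?_) (Subtype.ext (LinearMap.ext fun x => ?_)) <;> rfl

theorem dualEquiv_smul (φ : Y →ₗ[A] X) (t : (T2 A)ᵐᵒᵖ) (f : Module.Dual (T2 A) (Triple φ)) :
    dualEquiv φ (t • f) = opEquiv A t • dualEquiv φ f := by
  refine Prod.ext (LinearMap.ext fun x => ?_) (Subtype.ext (LinearMap.ext fun x => ?_))
  · change (f (mk φ x 0) * t.unop).1 0 1 = (f (mk φ x 0)).1 0 1 * t.unop.1 1 1 +
      (f (mk φ x 0)).1 0 0 * t.unop.1 0 1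
    rw [mul_apply_zero_one, add_comm]
  · change (f (mk φ x 0) * t.unop).1 0 0 = (f (mk φ x 0)).1 0 0 * t.unop.1 0 0
    rw [mul_apply_zero_zero]

/-- `(X, Y)_φ` is semi-Gorenstein-projective if `X` and `Y` are and all maps `Y → A` extend
along `φ`. -/
theorem isSemiGorensteinProjective {φ : Y →ₗ[A] X} (hX : IsSemiGorensteinProjective A X)
    (hY : IsSemiGorensteinProjective A Y) (hφ : ∀ k : Y →ₗ[A] A, ∃ l : X →ₗ[A] A, l ∘ₗ φ = k) :
    IsSemiGorensteinProjective (T2 A) (Triple φ) := by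
  have := hX.1
  have := hY.1
  refine ⟨inferInstance, fun i hi => ?_⟩
  obtain ⟨j, rfl⟩ := Nat.exists_eq_add_of_le' hi
  exact subsingleton_ext_succ j φ hX.2 hY.2 hφ

theorem isSemiGorensteinProjective_dual {φ : Y →ₗ[A] X} 
    (h : IsSemiGorensteinProjective (T2 Aᵐᵒᵖ) (DualTriple φ)) :
    IsSemiGorensteinProjective (T2 A)ᵐᵒᵖ (Module.Dual (T2 A) (Triple φ)) := by
  have := h.1
  refine ⟨?_, fun i hi => subsingleton_ext_of_ringEquiv (opEquiv A) (dualEquiv φ)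
    (dualEquiv_smul φ) (opEquiv A).toAddEquiv (map_mul (opEquiv A)) (h.2 i hi)⟩
  have : RingHomSurjective ((opEquiv A).symm : T2 Aᵐᵒᵖ →+* (T2 A)ᵐᵒᵖ) :=
    ⟨(opEquiv A).symm.surjective⟩
  let e : DualTriple φ →ₛₗ[((opEquiv A).symm : T2 Aᵐᵒᵖ →+* (T2 A)ᵐᵒᵖ)] Module.Dual (T2 A) (Triple φ) :=
    { (dualEquiv φ).symm with
      map_smul' := fun t v => by
        change (dualEquiv φ).symm (t • v) = (opEquiv A).symm t • (dualEquiv φ).symm v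
        rw [AddEquiv.symm_apply_eq, dualEquiv_smul, RingEquiv.apply_symm_apply,
          AddEquiv.apply_symm_apply] }
  exact Module.Finite.of_surjective e (dualEquiv φ).symm.surjective

end Triple

theorem IsMonic.of_injective {M N : Type u} [AddCommGroup M] [Module (T2 A) M] [AddCommGroup N]
    [Module (T2 A) N] {f : M →ₗ[T2 A] N} (hf : Function.Injective f) (hN : IsMonic (A := A) N) :
    IsMonic (A := A) M := by
  rintro _ ⟨v, rfl⟩ _ ⟨w, rfl⟩ h
  refine hf (hN ⟨f v, (map_smul f _ _).symm⟩ ⟨f w, (map_smul f _ _).symm⟩ ?_)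
  simpa using congrArg f h

/-- Elements of `e22 T_2(A)` have only a lower right entry, and `e12` moves it to the upper right.
-/
theorem isMonic_finsupp (ι : Type u) : IsMonic (A := A) (ι →₀ T2 A) := by
  rintro _ ⟨v, rfl⟩ _ ⟨w, rfl⟩ h
  refine Finsupp.ext fun i => ?_
  have hi := congrArg (fun t : T2 A => t.1 0 1) (DFunLike.congr_fun h i)
  ext
  · simp [e22]
  · simp [e22]
  · simpa [e12, e22] using hi

theorem isMonic_of_isTorsionlessModule {M : Type u} [AddCommGroup M] [Module (T2 A) M]
    (h : IsTorsionlessModule (T2 A) M) : IsMonic (A := A) M := by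
  obtain ⟨Q, _, _, f, -, hQ, hf⟩ := h
  obtain ⟨s, hs⟩ := (Module.projective_def' (R := T2 A) (P := Q)).1 hQ
  have hs' : Function.LeftInverse (Finsupp.linearCombination (T2 A) id) s :=
    fun x => LinearMap.congr_fun hs x
  exact IsMonic.of_injective (f := s ∘ₗ f) (hs'.injective.comp hf) (isMonic_finsupp Q)

end T2

theorem theorem1p7
    -- `A` is an Artin algebra over the commutative Artinian ring `R`
    {R : Type*} [CommRing R] [IsArtinianRing R]
    {A : Type u} [Ring A] [Algebra R A] [Module.Finite R A]
    {Y P : Type u} [AddCommGroup Y] [Module A Y] [AddCommGroup P] [Module A P]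
    (hY : IsDoubleSemiGorensteinProjective A Y)
    (hYt : ¬ IsTorsionlessModule A Y)
    (φ : Y →ₗ[A] P) (hφ : IsLeftAddApproximation φ) :
    IsDoubleSemiGorensteinProjective (T2 A) (T2.Triple φ) ∧
      ¬ T2.IsMonic (A := A) (T2.Triple φ) ∧
      ¬ IsTorsionlessModule (T2 A) (T2.Triple φ) := by
  have hP : IsSemiGorensteinProjective A P := by
    have := hφ.1.projective
    exact ⟨hφ.1.finite, fun i hi => subsingleton_ext_of_projective hi⟩
  have hmonic : ¬ T2.IsMonic (A := A) (T2.Triple φ) := fun h =>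
    hYt ⟨P, _, _, φ, hφ.1.finite, hφ.1.projective, (T2.isMonic_triple φ).1 h⟩
  refine ⟨⟨T2.Triple.isSemiGorensteinProjective hP hY.1 hφ.exists_comp_eq,
    T2.Triple.isSemiGorensteinProjective_dual ?_⟩, hmonic,
    fun h => hmonic (T2.isMonic_of_isTorsionlessModule h)⟩
  have hproj := hφ.1.projective_dual
  have hfin := hφ.1.finite_dual
  have : Module.Finite R Aᵐᵒᵖ := Module.Finite.equiv (MulOpposite.opLinearEquiv R)
  -- Makes `Ker φ^*`, a submodule of `P^*`, finitely generated; the Artin hypothesis enters only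
  -- here.
  have : IsNoetherianRing Aᵐᵒᵖ := IsNoetherianRing.of_finite R Aᵐᵒᵖ
  have hsurj : Function.Surjective (opDualMap φ) := hφ.exists_comp_eq
  have hex := LinearMap.exact_subtype_ker_map (opDualMap φ)
  have hinj := Submodule.subtype_injective (LinearMap.ker (opDualMap φ))
  refine T2.Triple.isSemiGorensteinProjective
    ⟨hfin, fun i hi => subsingleton_ext_of_projective hi⟩ ⟨inferInstance, fun i hi => ?_⟩ ?_
  -- `Ext^i(Ker φ^*, A)` vanishes with `Ext^(i+1)(Y^*, A)`, and `Ext¹(Y^*, A) = 0` extends maps from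
  -- `Ker φ^*` to `P^*`.
  · exact (subsingleton_ext_succ_iff hex hinj hsurj hi).1 (hY.2.2 _ (Nat.le_add_left 1 i))
  · exact (subsingleton_ext_one_iff (K := LinearMap.ker (opDualMap φ)) hex hinj hsurj).1
      (hY.2.2 1 le_rfl)
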